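/- Let $M_n$ be the set of $n\times n$ complex matrices. For $Z\in M_n$ put $|Z|=(Z^*Z)^{1/2}$ and $|Z|_{\mathrm{sym}}=\tfrac12\bigl(|Z|+|Z^*|\bigr)$. For $1\le p<\infty$ let $\|X\|_p=(\operatorname{tr}|X|^p)^{1/p}$ be the Schatten $p$-norm, and let $\|X\|_\infty$ be the operator norm (the largest singular value); put $1/\infty=0$. Let $1\le p\le\infty$. (a) For all $m,n$ and all $A_1,\dots,A_m\in M_n$, \[ \Bigl\|\sum_{k=1}^m A_k\Bigr\|_p\ \le\ 2^{1-\frac1p}\,\Bigl\|\sum_{k=1}^m |A_k|_{\mathrm{sym}}\Bigr\|_p . \] (b) The constant $2^{1-1/p}$ is sharp: for every $m\ge1$ and every $n\ge2$, if a real number $c$ satisfies $\bigl\|\sum_{k=1}^m A_k\bigr\|_p\le c\,\bigl\|\sum_{k=1}^m |A_k|_{\mathrm{sym}}\bigr\|_p$ for all $A_1,\dots,A_m\in M_n$, then $c\ge 2^{1-1/p}$. Moreover, for $m\ge1$ and $n\ge2$, equality with nonzero sides holds in (a) when $A_1=\dots=A_m=E_{12}$, where $E_{12}\in M_n$ is the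 matrix unit with entry $1$ at position $(1,2)$ and $0$ elsewhere. -/

import Mathlib

open scoped ENNReal MatrixOrder

noncomputable section

/-- The arithmetic symmetric modulus `|Z|_sym = (|Z| + |Z*|) / 2` of a complex square matrix, where
`|Z| = (Z* Z)^(1/2)` is `CFC.abs Z` and `Z*` is the conjugate transpose. -/
def symModulus {n : ℕ} (Z : Matrix (Fin n) (Fin n) ℂ) : Matrix (Fin n) (Fin n) ℂ :=
  (2⁻¹ : ℂ) • (CFC.abs Z + CFC.abs Z.conjTranspose)

/-- The Schatten `p`-norm `(tr |X|^p)^(1/p)` of a complex square matrix; for `p = ∞` it is the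
operator norm with respect to the Euclidean norm (the largest singular value). The trace of the
positive semidefinite matrix `|X|^p` is a nonnegative real, so that taking its real part only
changes the type. -/
def schattenNorm {n : ℕ} (p : ℝ≥0∞) (X : Matrix (Fin n) (Fin n) ℂ) : ℝ :=
  if p = ∞ then ‖Matrix.toEuclideanCLM (n := Fin n) (𝕜 := ℂ) X‖
  else (CFC.rpow (CFC.abs X) p.toReal).trace.re ^ (1 / p.toReal)

end

section
open Matrix
open scoped ComplexOrder
variable {ι : Type*} [Fintype ι] [DecidableEq ι]

/-- The action of a matrix on Euclidean space. -/
local notation "𝓛" => Matrix.toEuclideanCLM (n := ι) (𝕜 := ℂ)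

/-! The polar decomposition `A = U|A|` gives `Re⟪x, A y⟫ ≤ (⟪x, |A*| x⟫ + ⟪y, |A| y⟫) / 2`
(`re_inner_toEuclideanCLM_le`). This bound is additive in `A`: the sum `S` of the `A k` is
controlled by `P = ½ ∑ |A k*|` and `Q = ½ ∑ |A k|`, and `P + Q` is the sum of the symmetric moduli.
At singular vectors of `S` it reads `s i ≤ ⟪u i, P u i⟫ + ⟪v i, Q v i⟫`. For finite `p`, convexity
of `t ^ p` costs the factor `2 ^ (p - 1)`, and `sum_rpow_add_sum_rpow_le` bounds the remaining sums
by `tr (P + Q) ^ p`, although `u` and `v` are different bases. For `p = ∞`, unit vectors and `P, Q ≤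
P + Q` suffice. For sharpness, `|E₁₂|_sym` is half a projection of rank two, while `|E₁₂|` is a
projection of rank one. -/

lemma inner_toEuclideanCLM_left (A : Matrix ι ι ℂ) (x y : EuclideanSpace ℂ ι) :
    inner ℂ (𝓛 A x) y = inner ℂ x (𝓛 Aᴴ y) := by
  rw [← star_eq_conjTranspose, map_star, ContinuousLinearMap.star_eq_adjoint,
    ContinuousLinearMap.adjoint_inner_right]

lemma inner_toEuclideanCLM_conjTranspose_mul (A : Matrix ι ι ℂ) (x y : EuclideanSpace ℂ ι) :
    inner ℂ x (𝓛 (Aᴴ * A) y) = inner ℂ (𝓛 A x) (𝓛 A y) := by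
  rw [inner_toEuclideanCLM_left, map_mul]; rfl

lemma re_inner_toEuclideanCLM_nonneg {P : Matrix ι ι ℂ} (hP : 0 ≤ P) (x : EuclideanSpace ℂ ι) :
    0 ≤ (inner ℂ x (𝓛 P x)).re := by
  have h := CFC.sqrt_mul_sqrt_self P hP
  have hs : (CFC.sqrt P)ᴴ = CFC.sqrt P :=
    (nonneg_iff_posSemidef.1 (CFC.sqrt_nonneg P)).isHermitian
  rw [← h]
  nth_rw 1 [← hs]
  rw [inner_toEuclideanCLM_conjTranspose_mul]
  exact inner_self_nonneg (𝕜 := ℂ)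

lemma re_inner_toEuclideanCLM_mono {P Q : Matrix ι ι ℂ} (h : P ≤ Q) (x : EuclideanSpace ℂ ι) :
    (inner ℂ x (𝓛 P x)).re ≤ (inner ℂ x (𝓛 Q x)).re := by
  have := re_inner_toEuclideanCLM_nonneg (sub_nonneg.2 h) x
  rw [map_sub, _root_.sub_apply, inner_sub_right, Complex.sub_re] at this
  linarith

lemma isHermitian_cfcAbs (A : Matrix ι ι ℂ) : (CFC.abs A).IsHermitian :=
  (nonneg_iff_posSemidef.1 (CFC.abs_nonneg A)).isHermitian

/-! ### Eigenbases, singular vectors and polar decomposition. -/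

lemma Matrix.IsHermitian.toEuclideanCLM_eigenvectorBasis {A : Matrix ι ι ℂ} (hA : A.IsHermitian)
    (i : ι) : 𝓛 A (hA.eigenvectorBasis i) = (hA.eigenvalues i : ℂ) • hA.eigenvectorBasis i := by
  have := hA.mulVec_eigenvectorBasis i
  ext j
  have := congrFun this j
  simpa using this

lemma Matrix.IsHermitian.inner_toEuclideanCLM_eigenvectorBasis {A : Matrix ι ι ℂ}
    (hA : A.IsHermitian) (i : ι) :
    inner ℂ (hA.eigenvectorBasis i) (𝓛 A (hA.eigenvectorBasis i)) = hA.eigenvalues i := by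
  rw [hA.toEuclideanCLM_eigenvectorBasis, inner_smul_right, inner_self_eq_norm_sq_to_K]
  simp

lemma inner_toEuclideanCLM_eq_inner_cfcAbs (A : Matrix ι ι ℂ) (x y : EuclideanSpace ℂ ι) :
    inner ℂ (𝓛 A x) (𝓛 A y) = inner ℂ (𝓛 (CFC.abs A) x) (𝓛 (CFC.abs A) y) := by
  rw [← inner_toEuclideanCLM_conjTranspose_mul, ← inner_toEuclideanCLM_conjTranspose_mul,
    (isHermitian_cfcAbs A).eq, CFC.abs_mul_abs, star_eq_conjTranspose]

/-- Singular value decomposition: the right singular vectors are an eigenbasis of `|A|`. -/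
lemma exists_orthonormalBasis_singular (A : Matrix ι ι ℂ) :
    ∃ u : OrthonormalBasis ι ℂ (EuclideanSpace ℂ ι), ∀ i,
      𝓛 A ((isHermitian_cfcAbs A).eigenvectorBasis i) =
        ((isHermitian_cfcAbs A).eigenvalues i : ℂ) • u i := by
  set hA := isHermitian_cfcAbs A
  set v := hA.eigenvectorBasis
  set s := hA.eigenvalues
  have hin : ∀ i j, inner ℂ (𝓛 A (v i)) (𝓛 A (v j)) = (s i : ℂ) * s j * if i = j then 1 else 0 := by
    intro i j
    rw [inner_toEuclideanCLM_eq_inner_cfcAbs, hA.toEuclideanCLM_eigenvectorBasis,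
      hA.toEuclideanCLM_eigenvectorBasis, inner_smul_left, inner_smul_right,
      orthonormal_iff_ite.1 hA.eigenvectorBasis.orthonormal i j, Complex.conj_ofReal, mul_assoc]
  -- Only the images with nonzero singular value can be normalised; they are extended to a full
  -- basis, and where `s i = 0` both sides vanish.
  have ho : Orthonormal ℂ ({i | s i ≠ 0}.domRestrict fun i => ((s i)⁻¹ : ℂ) • 𝓛 A (v i)) := by
    rw [orthonormal_iff_ite]
    rintro ⟨i, hi⟩ ⟨j, hj⟩
    have hi' : (s i : ℂ) ≠ 0 := by exact_mod_cast hi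
    have hj' : (s j : ℂ) ≠ 0 := by exact_mod_cast hj
    simp only [Set.domRestrict_apply, inner_smul_left, inner_smul_right, hin, Subtype.mk.injEq,
      map_inv₀, Complex.conj_ofReal]
    field_simp
  obtain ⟨u, hu⟩ := ho.exists_orthonormalBasis_extension_of_card_eq (by simp)
  refine ⟨u, fun i => ?_⟩
  by_cases hi : s i = 0
  · have := hin i i
    rw [hi] at this ⊢
    simpa using this
  · have hi' : (s i : ℂ) ≠ 0 := by exact_mod_cast hi
    rw [hu i hi, smul_smul, mul_inv_cancel₀ hi', one_smul]

/-- Polar decomposition with a unitary factor. -/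
lemma exists_unitary_mul_cfcAbs (A : Matrix ι ι ℂ) :
    ∃ U ∈ unitary (Matrix ι ι ℂ), A = U * CFC.abs A := by
  obtain ⟨u, hu⟩ := exists_orthonormalBasis_singular A
  set hA := isHermitian_cfcAbs A
  let W := (Unitary.linearIsometryEquiv (𝕜 := ℂ) (H := EuclideanSpace ℂ ι)).symm
    (hA.eigenvectorBasis.equiv u (Equiv.refl ι))
  have hW : ∀ i, (W : EuclideanSpace ℂ ι →L[ℂ] EuclideanSpace ℂ ι) (hA.eigenvectorBasis i) = u i :=
    fun i => by simp [W]
  refine ⟨(𝓛).symm W, Unitary.map_mem _ W.2, ?_⟩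
  refine (𝓛).injective (?_ : 𝓛 A = 𝓛 ((𝓛).symm _ * _))
  rw [map_mul, StarAlgEquiv.apply_symm_apply]
  apply ContinuousLinearMap.coe_injective
  refine hA.eigenvectorBasis.toBasis.ext fun i => ?_
  simp [hu, hA.toEuclideanCLM_eigenvectorBasis, hW]

/-- Both sides are positive square roots of `A * Aᴴ`. -/
lemma cfcAbs_conjTranspose_eq {A U : Matrix ι ι ℂ} (hU : U ∈ unitary (Matrix ι ι ℂ))
    (h : A = U * CFC.abs A) : CFC.abs Aᴴ = U * CFC.abs A * star U := by
  have h0 : 0 ≤ U * CFC.abs A * star U := star_right_conjugate_nonneg (CFC.abs_nonneg A) U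
  refine (CFC.mul_self_eq_mul_self_iff _ _ (CFC.abs_nonneg _) h0).1 ?_
  rw [CFC.abs_mul_abs, star_eq_conjTranspose, conjTranspose_conjTranspose]
  have hs : star A = CFC.abs A * star U := by
    conv_lhs => rw [h, star_mul, (isHermitian_cfcAbs A).isSelfAdjoint.star_eq]
  calc A * Aᴴ = (U * CFC.abs A) * (CFC.abs A * star U) := by
        rw [← star_eq_conjTranspose, hs, ← h]
    _ = U * CFC.abs A * (star U * U) * CFC.abs A * star U := by
        rw [Unitary.star_mul_self_of_mem hU]; simp only [mul_assoc, mul_one]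
    _ = _ := by simp only [mul_assoc]

lemma re_inner_toEuclideanCLM_le (A : Matrix ι ι ℂ) (x y : EuclideanSpace ℂ ι) :
    (inner ℂ x (𝓛 A y)).re ≤
      2⁻¹ * ((inner ℂ x (𝓛 (CFC.abs Aᴴ) x)).re + (inner ℂ y (𝓛 (CFC.abs A) y)).re) := by
  obtain ⟨U, hU, h⟩ := exists_unitary_mul_cfcAbs A
  rw [cfcAbs_conjTranspose_eq hU h]
  set H := CFC.abs A with hH
  have hHh : Hᴴ = H := (isHermitian_cfcAbs A).eq
  set w := 𝓛 (star U) x with hw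
  have e1 : inner ℂ x (𝓛 A y) = inner ℂ w (𝓛 H y) := by
    rw [h, map_mul, hw, inner_toEuclideanCLM_left, star_eq_conjTranspose,
      conjTranspose_conjTranspose]; rfl
  have e2 : inner ℂ x (𝓛 (U * H * star U) x) = inner ℂ w (𝓛 H w) := by
    rw [map_mul, map_mul, hw, inner_toEuclideanCLM_left, star_eq_conjTranspose,
      conjTranspose_conjTranspose]; rfl
  have e3 : (inner ℂ y (𝓛 H w)).re = (inner ℂ w (𝓛 H y)).re := by
    rw [← inner_conj_symm, Complex.conj_re, inner_toEuclideanCLM_left, hHh]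
  -- With `w = U* x`, the claim is the expansion of `⟪w - y, |A| (w - y)⟫ ≥ 0`.
  have := re_inner_toEuclideanCLM_nonneg (CFC.abs_nonneg A) (w - y)
  rw [← hH] at this
  simp only [map_sub, inner_sub_left, inner_sub_right, Complex.sub_re, e3] at this
  rw [e1, e2]
  linarith

/-! ### Jensen's inequality and McCarthy's inequality. -/

lemma Real.rpow_sum_mul_le_sum_mul_rpow {κ : Type*} (s : Finset κ) {p : ℝ} (hp : 1 ≤ p)
    (w f : κ → ℝ) (hw : ∀ i, 0 ≤ w i) (hf : ∀ i, 0 ≤ f i) (h1 : ∑ i ∈ s, w i ≤ 1) :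
    (∑ i ∈ s, w i * f i) ^ p ≤ ∑ i ∈ s, w i * f i ^ p := by
  have hp0 : 0 < p := by linarith
  have hS : 0 ≤ ∑ i ∈ s, w i * f i ^ p :=
    Finset.sum_nonneg fun i _ => mul_nonneg (hw i) (Real.rpow_nonneg (hf i) p)
  have h := Real.inner_le_weight_mul_Lp_of_nonneg s hp w f hw hf
  have h2 : (∑ i ∈ s, w i) ^ (1 - p⁻¹) ≤ 1 :=
    Real.rpow_le_one (Finset.sum_nonneg fun i _ => hw i) h1 (sub_nonneg.2 (inv_le_one_of_one_le₀ hp))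
  have h3 : ∑ i ∈ s, w i * f i ≤ (∑ i ∈ s, w i * f i ^ p) ^ p⁻¹ :=
    h.trans (mul_le_of_le_one_left (Real.rpow_nonneg hS _) h2)
  calc _ ≤ ((∑ i ∈ s, w i * f i ^ p) ^ p⁻¹) ^ p :=
        Real.rpow_le_rpow (Finset.sum_nonneg fun i _ => mul_nonneg (hw i) (hf i)) h3 hp0.le
    _ = _ := Real.rpow_inv_rpow hS hp0.ne'

lemma Matrix.IsHermitian.re_inner_toEuclideanCLM_eq_sum {C : Matrix ι ι ℂ} (hC : C.IsHermitian)
    (x : EuclideanSpace ℂ ι) :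
    (inner ℂ x (𝓛 C x)).re =
      ∑ j, hC.eigenvalues j * ‖inner ℂ (hC.eigenvectorBasis j) x‖ ^ 2 := by
  rw [← hC.eigenvectorBasis.sum_inner_mul_inner x (𝓛 C x), Complex.re_sum]
  refine Finset.sum_congr rfl fun j _ => ?_
  have : inner ℂ (hC.eigenvectorBasis j) (𝓛 C x) =
      hC.eigenvalues j * inner ℂ (hC.eigenvectorBasis j) x := by
    have := inner_toEuclideanCLM_left C (hC.eigenvectorBasis j) x
    rw [hC.eq, hC.toEuclideanCLM_eigenvectorBasis, inner_smul_left, Complex.conj_ofReal] at this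
    exact this.symm
  rw [this, mul_left_comm, ← inner_conj_symm, Complex.conj_mul']
  norm_cast

lemma toEuclideanCLM_sqrt_norm_sq {P : Matrix ι ι ℂ} (hP : 0 ≤ P) (x : EuclideanSpace ℂ ι) :
    ‖𝓛 (CFC.sqrt P) x‖ ^ 2 = (inner ℂ x (𝓛 P x)).re := by
  have hs : (CFC.sqrt P)ᴴ = CFC.sqrt P :=
    (nonneg_iff_posSemidef.1 (CFC.sqrt_nonneg P)).isHermitian
  have h := inner_toEuclideanCLM_conjTranspose_mul (CFC.sqrt P) x x
  rw [hs, CFC.sqrt_mul_sqrt_self P hP, inner_self_eq_norm_sq_to_K] at h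
  rw [h]
  norm_cast

lemma inner_toEuclideanCLM_sqrt (P : Matrix ι ι ℂ) (x y : EuclideanSpace ℂ ι) :
    inner ℂ x (𝓛 (CFC.sqrt P) y) = inner ℂ (𝓛 (CFC.sqrt P) x) y := by
  have hs : (CFC.sqrt P)ᴴ = CFC.sqrt P :=
    (nonneg_iff_posSemidef.1 (CFC.sqrt_nonneg P)).isHermitian
  rw [inner_toEuclideanCLM_left, hs]

lemma Matrix.IsHermitian.re_inner_eigenvectorBasis_le {P C : Matrix ι ι ℂ} (hPC : P ≤ C)
    (hC : C.IsHermitian) (j : ι) :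
    (inner ℂ (hC.eigenvectorBasis j) (𝓛 P (hC.eigenvectorBasis j))).re ≤ hC.eigenvalues j := by
  have := re_inner_toEuclideanCLM_mono hPC (hC.eigenvectorBasis j)
  rwa [hC.inner_toEuclideanCLM_eigenvectorBasis, Complex.ofReal_re] at this

/-- `⟪P^{1/2} u, C⁻¹ P^{1/2} u⟫ ≤ 1` for `0 ≤ P ≤ C` and a unit vector `u`, written in an eigenbasis
of `C`. -/
lemma Matrix.IsHermitian.sum_sq_norm_inner_sqrt_div_le_one {P C : Matrix ι ι ℂ} (hP : 0 ≤ P)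
    (hPC : P ≤ C) (hC : C.IsHermitian) {u : EuclideanSpace ℂ ι} (hu : ‖u‖ = 1) :
    ∑ j, ‖inner ℂ (hC.eigenvectorBasis j) (𝓛 (CFC.sqrt P) u)‖ ^ 2 / hC.eigenvalues j ≤ 1 := by
  set f := hC.eigenvectorBasis
  set c := hC.eigenvalues
  set y := 𝓛 (CFC.sqrt P) u with hy
  set t := ∑ j, ‖inner ℂ (f j) y‖ ^ 2 / c j
  -- `x` is the pseudo-inverse of `C` applied to `y` (`0⁻¹ = 0` handles the kernel), so `⟪x, C x⟫ =
  -- ⟪x, y⟫ = t`. Cauchy–Schwarz and `P ≤ C` then give `t ^ 2 ≤ t`.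
  set x : EuclideanSpace ℂ ι := ∑ j, (((c j)⁻¹ : ℝ) * inner ℂ (f j) y : ℂ) • f j with hx
  have hfx : ∀ j, inner ℂ (f j) x = ((c j)⁻¹ : ℝ) * inner ℂ (f j) y := fun j => by
    rw [hx, f.orthonormal.inner_right_fintype]
  have hxC : (inner ℂ x (𝓛 C x)).re = t := by
    rw [hC.re_inner_toEuclideanCLM_eq_sum]
    refine Finset.sum_congr rfl fun j _ => ?_
    rw [hfx, norm_mul, mul_pow, Complex.norm_real, Real.norm_eq_abs, sq_abs]
    change c j * _ = _
    by_cases h : c j = 0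
    · simp [h]
    · field_simp
  have hxy : inner ℂ x y = (t : ℂ) := by
    rw [← f.sum_inner_mul_inner x y, Complex.ofReal_sum]
    refine Finset.sum_congr rfl fun j _ => ?_
    rw [← inner_conj_symm, hfx, map_mul, Complex.conj_ofReal, mul_assoc, Complex.conj_mul']
    push_cast
    ring
  have h1 : |t| ≤ ‖𝓛 (CFC.sqrt P) x‖ := by
    have := norm_inner_le_norm (𝕜 := ℂ) (𝓛 (CFC.sqrt P) x) u
    rwa [← inner_toEuclideanCLM_sqrt, ← hy, hxy, hu, mul_one, Complex.norm_real] at this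
  have h2 : t ^ 2 ≤ t := by
    calc t ^ 2 = |t| ^ 2 := (sq_abs t).symm
      _ ≤ ‖𝓛 (CFC.sqrt P) x‖ ^ 2 := by gcongr
      _ ≤ t := by
        rw [toEuclideanCLM_sqrt_norm_sq hP, ← hxC]
        exact re_inner_toEuclideanCLM_mono hPC x
  nlinarith

/-- Jensen with weights `|⟪f j, P^{1/2} u i⟫|² / c j`, of total mass at most one for each `i`. The
right side is `tr (P C ^ (p - 1))`: it no longer depends on `u` and is additive in `P`. -/
lemma Matrix.IsHermitian.sum_rpow_re_inner_le {P C : Matrix ι ι ℂ} (hP : 0 ≤ P) (hPC : P ≤ C)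
    (hC : C.IsHermitian) (u : OrthonormalBasis ι ℂ (EuclideanSpace ℂ ι)) {p : ℝ} (hp : 1 ≤ p) :
    ∑ i, (inner ℂ (u i) (𝓛 P (u i))).re ^ p ≤
      ∑ j, (inner ℂ (hC.eigenvectorBasis j) (𝓛 P (hC.eigenvectorBasis j))).re *
        hC.eigenvalues j ^ (p - 1) := by
  have hle := hC.re_inner_eigenvectorBasis_le hPC
  set f := hC.eigenvectorBasis
  set c := hC.eigenvalues
  have hc : ∀ j, 0 ≤ c j := fun j => (re_inner_toEuclideanCLM_nonneg hP _).trans (hle j)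
  -- Since `P ≤ C`, the kernel of `C` lies in that of `P^{1/2}`, so nothing is lost where the weight
  -- divides by zero.
  have hz : ∀ i j, c j = 0 → inner ℂ (f j) (𝓛 (CFC.sqrt P) (u i)) = 0 := by
    intro i j h
    have h0 : ‖𝓛 (CFC.sqrt P) (f j)‖ ^ 2 ≤ 0 := by
      rw [toEuclideanCLM_sqrt_norm_sq hP, ← h]; exact hle j
    have : 𝓛 (CFC.sqrt P) (f j) = 0 := by
      rw [← norm_eq_zero]; exact pow_eq_zero_iff (two_ne_zero) |>.1 (le_antisymm h0 (by positivity))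
    rw [inner_toEuclideanCLM_sqrt, this, inner_zero_left]
  have hα : ∀ i, (inner ℂ (u i) (𝓛 P (u i))).re =
      ∑ j, ‖inner ℂ (f j) (𝓛 (CFC.sqrt P) (u i))‖ ^ 2 / c j * c j := by
    intro i
    rw [← toEuclideanCLM_sqrt_norm_sq hP, ← f.sum_sq_norm_inner_right]
    refine Finset.sum_congr rfl fun j _ => ?_
    by_cases h : c j = 0
    · simp [hz i j h]
    · field_simp
  calc ∑ i, (inner ℂ (u i) (𝓛 P (u i))).re ^ p
      ≤ ∑ i, ∑ j, ‖inner ℂ (f j) (𝓛 (CFC.sqrt P) (u i))‖ ^ 2 / c j * c j ^ p := by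
        refine Finset.sum_le_sum fun i _ => ?_
        rw [hα]
        exact Real.rpow_sum_mul_le_sum_mul_rpow _ hp _ _
          (fun j => div_nonneg (by positivity) (hc j)) hc
          (hC.sum_sq_norm_inner_sqrt_div_le_one hP hPC (u.orthonormal.1 i))
    _ = ∑ j, (inner ℂ (f j) (𝓛 P (f j))).re * c j ^ (p - 1) := by
        -- Summing over `i` first, Parseval in the basis `u` turns the weights into `⟪f j, P f j⟫ /
        -- c j`.
        rw [Finset.sum_comm]
        refine Finset.sum_congr rfl fun j _ => ?_
        rw [← Finset.sum_mul, ← Finset.sum_div]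
        simp_rw [inner_toEuclideanCLM_sqrt]
        rw [u.sum_sq_norm_inner_left, toEuclideanCLM_sqrt_norm_sq hP]
        obtain h | h := (hc j).eq_or_lt
        · have : (inner ℂ (f j) (𝓛 P (f j))).re = 0 :=
            le_antisymm (h ▸ hle j) (re_inner_toEuclideanCLM_nonneg hP _)
          simp [this]
        · rw [Real.rpow_sub_one h.ne']; ring

/-- A form of McCarthy's inequality `tr P ^ p + tr Q ^ p ≤ tr (P + Q) ^ p`. -/
lemma Matrix.IsHermitian.sum_rpow_add_sum_rpow_le {P Q : Matrix ι ι ℂ} (hP : 0 ≤ P) (hQ : 0 ≤ Q)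
    (hC : (P + Q).IsHermitian) (u v : OrthonormalBasis ι ℂ (EuclideanSpace ℂ ι)) {p : ℝ}
    (hp : 1 ≤ p) :
    ∑ i, (inner ℂ (u i) (𝓛 P (u i))).re ^ p + ∑ i, (inner ℂ (v i) (𝓛 Q (v i))).re ^ p ≤
      ∑ j, hC.eigenvalues j ^ p := by
  refine (add_le_add (hC.sum_rpow_re_inner_le hP (le_add_of_nonneg_right hQ) u hp)
    (hC.sum_rpow_re_inner_le hQ (le_add_of_nonneg_left hP) v hp)).trans_eq ?_
  rw [← Finset.sum_add_distrib]
  refine Finset.sum_congr rfl fun j _ => ?_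
  have h := hC.inner_toEuclideanCLM_eigenvectorBasis j
  have h0 : 0 ≤ hC.eigenvalues j := by
    have := re_inner_toEuclideanCLM_nonneg (add_nonneg hP hQ) (hC.eigenvectorBasis j)
    rwa [h] at this
  rw [← add_mul, ← Complex.add_re, ← inner_add_right, ← _root_.add_apply, ← map_add, h,
    Complex.ofReal_re]
  obtain h | h := h0.eq_or_lt
  · rw [← h, zero_mul, Real.zero_rpow (by linarith)]
  · rw [Real.rpow_sub_one h.ne']; field_simp

lemma re_trace_rpow_eq_sum {C : Matrix ι ι ℂ} (h0 : 0 ≤ C) (hC : C.IsHermitian) (p : ℝ) :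
    (CFC.rpow C p).trace.re = ∑ j, hC.eigenvalues j ^ p := by
  change (C ^ p).trace.re = _
  rw [CFC.rpow_eq_cfc_real h0, hC.cfc_eq, IsHermitian.cfc, Unitary.conjStarAlgAut_apply,
    trace_mul_cycle, Unitary.coe_star_mul_self, one_mul, trace_diagonal, Complex.re_sum]
  rfl

end

/-! ### Schatten norms and the inequality. -/

section
open Matrix
open scoped ComplexOrder
variable {n : ℕ}
local notation "𝓛" => Matrix.toEuclideanCLM (n := Fin n) (𝕜 := ℂ)

lemma schattenNorm_top (X : Matrix (Fin n) (Fin n) ℂ) : schattenNorm ∞ X = ‖𝓛 X‖ := by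
  simp [schattenNorm]

lemma schattenNorm_eq_sum {p : ℝ≥0∞} (hp : p ≠ ∞) (X : Matrix (Fin n) (Fin n) ℂ) :
    schattenNorm p X =
      (∑ j, (isHermitian_cfcAbs X).eigenvalues j ^ p.toReal) ^ (1 / p.toReal) := by
  rw [schattenNorm, if_neg hp, re_trace_rpow_eq_sum (CFC.abs_nonneg X) (isHermitian_cfcAbs X)]

lemma schattenNorm_eq_sum_of_nonneg {p : ℝ≥0∞} (hp : p ≠ ∞) {C : Matrix (Fin n) (Fin n) ℂ}
    (h : 0 ≤ C) (hC : C.IsHermitian) :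
    schattenNorm p C = (∑ j, hC.eigenvalues j ^ p.toReal) ^ (1 / p.toReal) := by
  rw [schattenNorm, if_neg hp, CFC.abs_of_nonneg C h, re_trace_rpow_eq_sum h hC]

lemma norm_toEuclideanCLM_conjTranspose_mul_self (X : Matrix (Fin n) (Fin n) ℂ) :
    ‖𝓛 (Xᴴ * X)‖ = ‖𝓛 X‖ * ‖𝓛 X‖ := by
  rw [map_mul, ← star_eq_conjTranspose, map_star]
  exact ContinuousLinearMap.norm_adjoint_comp_self (𝓛 X)

lemma schattenNorm_cfcAbs (p : ℝ≥0∞) (X : Matrix (Fin n) (Fin n) ℂ) :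
    schattenNorm p (CFC.abs X) = schattenNorm p X := by
  by_cases hp : p = ∞
  · subst hp
    have h := congrArg (fun Y => ‖𝓛 Y‖) (CFC.abs_mul_abs X)
    nth_rw 1 [← (isHermitian_cfcAbs X).eq] at h
    simp only [star_eq_conjTranspose, norm_toEuclideanCLM_conjTranspose_mul_self] at h
    rw [schattenNorm_top, schattenNorm_top]
    exact (mul_self_inj (norm_nonneg _) (norm_nonneg _)).1 h
  · rw [schattenNorm, schattenNorm, if_neg hp, if_neg hp, CFC.cfcAbs_cfcAbs]

lemma re_inner_toEuclideanCLM_le_norm (C : Matrix (Fin n) (Fin n) ℂ)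
    {x : EuclideanSpace ℂ (Fin n)} (hx : ‖x‖ = 1) : (inner ℂ x (𝓛 C x)).re ≤ ‖𝓛 C‖ := by
  have h1 := norm_inner_le_norm (𝕜 := ℂ) x (𝓛 C x)
  have h2 := (𝓛 C).le_opNorm x
  rw [hx] at h1 h2
  linarith [Complex.re_le_norm (inner ℂ x (𝓛 C x))]

lemma norm_toEuclideanCLM_le_two_mul {S P Q : Matrix (Fin n) (Fin n) ℂ} (hP : 0 ≤ P) (hQ : 0 ≤ Q)
    (h : ∀ x y, (inner ℂ x (𝓛 S y)).re ≤ (inner ℂ x (𝓛 P x)).re + (inner ℂ y (𝓛 Q y)).re) :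
    ‖𝓛 S‖ ≤ 2 * ‖𝓛 (P + Q)‖ := by
  refine ContinuousLinearMap.opNorm_le_of_unit_norm (by positivity) fun y hy => ?_
  by_cases h0 : 𝓛 S y = 0
  · rw [h0, norm_zero]; positivity
  have hn : ‖𝓛 S y‖ ≠ 0 := norm_ne_zero_iff.2 h0
  -- The unit vector along `S y` makes `Re⟪x, S y⟫` equal to `‖S y‖`.
  set x : EuclideanSpace ℂ (Fin n) := ((‖𝓛 S y‖⁻¹ : ℝ) : ℂ) • 𝓛 S y with hx
  have hx1 : ‖x‖ = 1 := by
    rw [hx, norm_smul, Complex.norm_real, norm_inv, norm_norm, inv_mul_cancel₀ hn]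
  have hxS : (inner ℂ x (𝓛 S y)).re = ‖𝓛 S y‖ := by
    rw [hx, inner_smul_left, Complex.conj_ofReal, Complex.re_ofReal_mul,
      show (inner ℂ (𝓛 S y) (𝓛 S y)).re = ‖𝓛 S y‖ ^ 2 from inner_self_eq_norm_sq (𝕜 := ℂ) _]
    field_simp
  have := h x y
  have hPx := (re_inner_toEuclideanCLM_mono (le_add_of_nonneg_right hQ : P ≤ P + Q) x).trans
    (re_inner_toEuclideanCLM_le_norm _ hx1)
  have hQy := (re_inner_toEuclideanCLM_mono (le_add_of_nonneg_left hP : Q ≤ P + Q) y).trans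
    (re_inner_toEuclideanCLM_le_norm _ hy)
  linarith

lemma Real.rpow_add_le_two_rpow_mul {a b p : ℝ} (ha : 0 ≤ a) (hb : 0 ≤ b) (hp : 1 ≤ p) :
    (a + b) ^ p ≤ 2 ^ (p - 1) * (a ^ p + b ^ p) := by
  lift a to NNReal using ha
  lift b to NNReal using hb
  exact_mod_cast NNReal.rpow_add_le_mul_rpow_add_rpow a b hp

lemma schattenNorm_le_of_re_inner_le {p : ℝ≥0∞} (hp : 1 ≤ p) {S P Q : Matrix (Fin n) (Fin n) ℂ}
    (hP : 0 ≤ P) (hQ : 0 ≤ Q)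
    (h : ∀ x y, (inner ℂ x (𝓛 S y)).re ≤ (inner ℂ x (𝓛 P x)).re + (inner ℂ y (𝓛 Q y)).re) :
    schattenNorm p S ≤ (2 : ℝ) ^ (1 - (p⁻¹).toReal) * schattenNorm p (P + Q) := by
  by_cases hpt : p = ∞
  · subst hpt
    simpa [schattenNorm_top] using norm_toEuclideanCLM_le_two_mul hP hQ h
  have hC : (P + Q).IsHermitian := (nonneg_iff_posSemidef.1 (add_nonneg hP hQ)).isHermitian
  rw [schattenNorm_eq_sum hpt, schattenNorm_eq_sum_of_nonneg hpt (add_nonneg hP hQ) hC,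
    ENNReal.toReal_inv]
  have hq : 1 ≤ p.toReal := by simpa using ENNReal.toReal_mono hpt hp
  generalize p.toReal = q at hq
  obtain ⟨u, hu⟩ := exists_orthonormalBasis_singular S
  set v := (isHermitian_cfcAbs S).eigenvectorBasis
  set s := (isHermitian_cfcAbs S).eigenvalues
  have hs0 : ∀ i, 0 ≤ s i := (nonneg_iff_posSemidef.1 (CFC.abs_nonneg S)).eigenvalues_nonneg
  have hc0 : ∀ i, 0 ≤ hC.eigenvalues i :=
    (nonneg_iff_posSemidef.1 (add_nonneg hP hQ)).eigenvalues_nonneg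
  have hs : ∀ i, s i ≤ (inner ℂ (u i) (𝓛 P (u i))).re + (inner ℂ (v i) (𝓛 Q (v i))).re := by
    intro i
    have := h (u i) (v i)
    rwa [hu, inner_smul_right, inner_self_eq_norm_sq_to_K, u.orthonormal.1 i, RCLike.ofReal_one,
      one_pow, mul_one, Complex.ofReal_re] at this
  have key : ∑ i, s i ^ q ≤ 2 ^ (q - 1) * ∑ j, hC.eigenvalues j ^ q := by
    refine le_trans ?_ (mul_le_mul_of_nonneg_left
      (hC.sum_rpow_add_sum_rpow_le hP hQ u v hq) (by positivity))
    rw [← Finset.sum_add_distrib, Finset.mul_sum]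
    refine Finset.sum_le_sum fun i _ => ?_
    exact (Real.rpow_le_rpow (hs0 i) (hs i) (by linarith)).trans
      (Real.rpow_add_le_two_rpow_mul (re_inner_toEuclideanCLM_nonneg hP _)
        (re_inner_toEuclideanCLM_nonneg hQ _) hq)
  calc _ ≤ (2 ^ (q - 1) * ∑ j, hC.eigenvalues j ^ q) ^ (1 / q) :=
        Real.rpow_le_rpow (Finset.sum_nonneg fun i _ => Real.rpow_nonneg (hs0 i) _) key
          (by positivity)
    _ = _ := by
        rw [Real.mul_rpow (by positivity)
          (Finset.sum_nonneg fun i _ => Real.rpow_nonneg (hc0 i) _), ← Real.rpow_mul (by norm_num)]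
        congr 2
        field_simp

theorem schattenNorm_sum_le {p : ℝ≥0∞} (hp : 1 ≤ p) {m : ℕ}
    (A : Fin m → Matrix (Fin n) (Fin n) ℂ) :
    schattenNorm p (∑ k, A k) ≤
      (2 : ℝ) ^ (1 - (p⁻¹).toReal) * schattenNorm p (∑ k, symModulus (A k)) := by
  have hsplit : ∑ k, symModulus (A k) =
      ∑ k, (2⁻¹ : ℂ) • CFC.abs (A k)ᴴ + ∑ k, (2⁻¹ : ℂ) • CFC.abs (A k) := by
    rw [← Finset.sum_add_distrib]
    exact Finset.sum_congr rfl fun k _ => by rw [symModulus, smul_add, add_comm]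
  have hnn : ∀ B : Matrix (Fin n) (Fin n) ℂ, 0 ≤ (2⁻¹ : ℂ) • CFC.abs B := fun B =>
    nonneg_iff_posSemidef.2 ((nonneg_iff_posSemidef.1 (CFC.abs_nonneg B)).smul (by positivity))
  have hhalf : ∀ z : ℂ, ((2⁻¹ : ℂ) * z).re = 2⁻¹ * z.re := fun z => by
    rw [← Complex.re_ofReal_mul]; norm_num
  rw [hsplit]
  refine schattenNorm_le_of_re_inner_le hp (Finset.sum_nonneg fun k _ => hnn _)
    (Finset.sum_nonneg fun k _ => hnn _) fun x y => ?_
  simp only [map_sum, map_smul, _root_.sum_apply, _root_.smul_apply, inner_sum, inner_smul_right,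
    Complex.re_sum, hhalf]
  rw [← Finset.sum_add_distrib]
  refine Finset.sum_le_sum fun k _ => ?_
  rw [← mul_add]
  exact re_inner_toEuclideanCLM_le (A k) x y

/-! ### The equality case and sharpness. -/

/-- Such a `D` is `r` times a projection: its eigenvalues are `0` or `r`, and the trace counts the
latter. Both sides of the equality case reduce to this. -/
lemma schattenNorm_of_mul_self_eq_smul (p : ℝ≥0∞) (hp : 1 ≤ p) {D : Matrix (Fin n) (Fin n) ℂ}
    {r : ℝ} (hr : 0 < r) (hD : 0 ≤ D) (hD0 : D ≠ 0) (h : D * D = (r : ℂ) • D) :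
    schattenNorm p D = r ^ (1 - (p⁻¹).toReal) * D.trace.re ^ (p⁻¹).toReal := by
  have hH : D.IsHermitian := (nonneg_iff_posSemidef.1 hD).isHermitian
  by_cases hpt : p = ∞
  · subst hpt
    have h2 := norm_toEuclideanCLM_conjTranspose_mul_self D
    rw [hH.eq, h, map_smul, norm_smul, Complex.norm_real, Real.norm_of_nonneg hr.le] at h2
    have h3 : ‖𝓛 D‖ ≠ 0 := by
      rw [norm_ne_zero_iff]
      exact fun h0 => hD0 ((𝓛).injective (h0.trans (map_zero (𝓛)).symm))
    simpa [schattenNorm_top] using mul_right_cancel₀ h3 h2.symm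
  · have hq : 1 ≤ p.toReal := by simpa using ENNReal.toReal_mono hpt hp
    have hc0 := (nonneg_iff_posSemidef.1 hD).eigenvalues_nonneg
    have hc : ∀ j, hH.eigenvalues j * hH.eigenvalues j = r * hH.eigenvalues j := by
      intro j
      have h1 := inner_toEuclideanCLM_conjTranspose_mul D (hH.eigenvectorBasis j)
        (hH.eigenvectorBasis j)
      rw [hH.eq, h, map_smul, _root_.smul_apply, inner_smul_right,
        hH.inner_toEuclideanCLM_eigenvectorBasis, hH.toEuclideanCLM_eigenvectorBasis,
        inner_smul_left, inner_smul_right, inner_self_eq_norm_sq_to_K,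
        hH.eigenvectorBasis.orthonormal.1 j, Complex.conj_ofReal] at h1
      simp only [RCLike.ofReal_one, one_pow, mul_one] at h1
      exact_mod_cast h1.symm
    have htr : D.trace.re = ∑ j, hH.eigenvalues j := by
      rw [hH.trace_eq_sum_eigenvalues]; simp
    have hsum : ∑ j, hH.eigenvalues j ^ p.toReal = r ^ (p.toReal - 1) * D.trace.re := by
      rw [htr, Finset.mul_sum]
      refine Finset.sum_congr rfl fun j _ => ?_
      obtain h0 | h0 := (hc0 j).eq_or_lt
      · rw [← h0, mul_zero]; exact Real.zero_rpow (by linarith)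
      · rw [mul_right_cancel₀ h0.ne' (hc j), Real.rpow_sub_one hr.ne']; field_simp
    rw [schattenNorm_eq_sum_of_nonneg hpt hD hH, hsum, ENNReal.toReal_inv,
      Real.mul_rpow (by positivity) (htr ▸ Finset.sum_nonneg fun j _ => hc0 j),
      ← Real.rpow_mul hr.le]
    congr 2
    · field_simp
    · simp

lemma cfcAbs_eq_of_mul_self {X D : Matrix (Fin n) (Fin n) ℂ} (hD : 0 ≤ D) (h : D * D = Xᴴ * X) :
    CFC.abs X = D := CFC.sqrt_unique h hD

lemma single_self_nonneg (i : Fin n) : 0 ≤ single i i (1 : ℂ) := by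
  rw [nonneg_iff_posSemidef]
  simpa using posSemidef_conjTranspose_mul_self (single i i (1 : ℂ))

lemma cfcAbs_single (i j : Fin n) : CFC.abs (single i j (1 : ℂ)) = single j j 1 :=
  cfcAbs_eq_of_mul_self (single_self_nonneg j) (by simp)

lemma symModulus_single (i j : Fin n) :
    symModulus (single i j (1 : ℂ)) = (2⁻¹ : ℂ) • (single j j 1 + single i i 1) := by
  rw [symModulus, cfcAbs_single, conjTranspose_single, star_one, cfcAbs_single]

lemma schattenNorm_natCast_smul_single (p : ℝ≥0∞) (hp : 1 ≤ p) {m : ℕ} (hm : 1 ≤ m)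
    (i j : Fin n) : schattenNorm p ((m : ℂ) • single i j (1 : ℂ)) = m := by
  have hm0 : (0 : ℝ) < m := by exact_mod_cast hm
  have hD : 0 ≤ (m : ℂ) • single j j (1 : ℂ) :=
    nonneg_iff_posSemidef.2
      ((nonneg_iff_posSemidef.1 (single_self_nonneg j)).smul (Nat.cast_nonneg m))
  have hD0 : (m : ℂ) • single j j (1 : ℂ) ≠ 0 := by
    intro h
    have := congrFun (congrFun h j) j
    simp at this
    omega
  have habs : CFC.abs ((m : ℂ) • single i j (1 : ℂ)) = (m : ℂ) • single j j (1 : ℂ) :=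
    cfcAbs_eq_of_mul_self hD (by simp)
  rw [← schattenNorm_cfcAbs, habs,
    schattenNorm_of_mul_self_eq_smul p hp hm0 hD hD0 (by simp), trace_smul, trace_single_eq_same,
    smul_eq_mul, mul_one, Complex.natCast_re, ← Real.rpow_add hm0]
  simp

lemma schattenNorm_half_natCast_smul (p : ℝ≥0∞) (hp : 1 ≤ p) {m : ℕ} (hm : 1 ≤ m)
    {i j : Fin n} (hij : i ≠ j) :
    (2 : ℝ) ^ (1 - (p⁻¹).toReal) *
      schattenNorm p ((m / 2 : ℂ) • (single j j (1 : ℂ) + single i i 1)) = m := by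
  have hm0 : (0 : ℝ) < m := by exact_mod_cast hm
  have hD : 0 ≤ (m / 2 : ℂ) • (single j j (1 : ℂ) + single i i 1) :=
    nonneg_iff_posSemidef.2
      ((nonneg_iff_posSemidef.1 (add_nonneg (single_self_nonneg j) (single_self_nonneg i))).smul
        (by positivity))
  have hD0 : (m / 2 : ℂ) • (single j j (1 : ℂ) + single i i 1) ≠ 0 := by
    intro h
    have := congrFun (congrFun h j) j
    simp [hij] at this
    omega
  have hmul : ((m / 2 : ℂ) • (single j j (1 : ℂ) + single i i 1)) *
      ((m / 2 : ℂ) • (single j j (1 : ℂ) + single i i 1)) =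
      ((m / 2 : ℝ) : ℂ) • ((m / 2 : ℂ) • (single j j (1 : ℂ) + single i i 1)) := by
    simp [mul_add, add_mul, hij, hij.symm]
  have htr : ((m / 2 : ℂ) • (single j j (1 : ℂ) + single i i 1)).trace.re = (m : ℝ) := by
    rw [trace_smul, trace_add, trace_single_eq_same, trace_single_eq_same]
    norm_num
  rw [schattenNorm_of_mul_self_eq_smul p hp (half_pos hm0) hD hD0 hmul, htr, ← mul_assoc,
    ← Real.mul_rpow (by norm_num) (by positivity), mul_div_cancel₀ _ two_ne_zero,
    ← Real.rpow_add hm0]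
  simp

theorem schattenNorm_sum_single_eq (p : ℝ≥0∞) (hp : 1 ≤ p) {m : ℕ} (hm : 1 ≤ m)
    {i j : Fin n} (hij : i ≠ j) {A : Fin m → Matrix (Fin n) (Fin n) ℂ}
    (hA : ∀ k, A k = single i j 1) :
    0 < schattenNorm p (∑ k, A k) ∧
      schattenNorm p (∑ k, A k) =
        (2 : ℝ) ^ (1 - (p⁻¹).toReal) * schattenNorm p (∑ k, symModulus (A k)) := by
  have h1 : ∑ k, A k = (m : ℂ) • single i j (1 : ℂ) := by
    simp only [hA, Finset.sum_const, Finset.card_univ, Fintype.card_fin, Nat.cast_smul_eq_nsmul]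
  have h2 : ∑ k, symModulus (A k) = (m / 2 : ℂ) • (single j j (1 : ℂ) + single i i 1) := by
    simp only [hA, symModulus_single, Finset.sum_const, Finset.card_univ, Fintype.card_fin]
    rw [← Nat.cast_smul_eq_nsmul ℂ, smul_smul, div_eq_mul_inv]
  rw [h1, h2, schattenNorm_natCast_smul_single p hp hm, schattenNorm_half_natCast_smul p hp hm hij]
  exact ⟨by exact_mod_cast hm, rfl⟩

end

theorem mainTheorem9 (p : ℝ≥0∞) (hp : 1 ≤ p) (m n : ℕ) :
    -- the inequality
    (∀ A : Fin m → Matrix (Fin n) (Fin n) ℂ,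
      schattenNorm p (∑ k, A k) ≤
        (2 : ℝ) ^ (1 - (p⁻¹).toReal) * schattenNorm p (∑ k, symModulus (A k))) ∧
    -- no smaller constant works
    (1 ≤ m → 2 ≤ n → ∀ c : ℝ,
      (∀ A : Fin m → Matrix (Fin n) (Fin n) ℂ,
        schattenNorm p (∑ k, A k) ≤ c * schattenNorm p (∑ k, symModulus (A k))) →
      (2 : ℝ) ^ (1 - (p⁻¹).toReal) ≤ c) ∧
    -- equality, with nonzero sides, holds when every `A k` is the matrix unit `E₁₂`
    (1 ≤ m → ∀ hn : 2 ≤ n, ∀ A : Fin m → Matrix (Fin n) (Fin n) ℂ,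
      (∀ k, A k = Matrix.single ⟨0, by omega⟩ ⟨1, by omega⟩ 1) →
      0 < schattenNorm p (∑ k, A k) ∧
      schattenNorm p (∑ k, A k) =
        (2 : ℝ) ^ (1 - (p⁻¹).toReal) * schattenNorm p (∑ k, symModulus (A k))) := by
  have hne : ∀ hn : 2 ≤ n, (⟨0, by omega⟩ : Fin n) ≠ ⟨1, by omega⟩ := fun hn => by simp
  refine ⟨fun A => schattenNorm_sum_le hp A, fun hm hn c hc => ?_,
    fun hm hn A hA => schattenNorm_sum_single_eq p hp hm (hne hn) hA⟩
  obtain ⟨h1, h2⟩ := schattenNorm_sum_single_eq p hp hm (hne hn)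
    (A := fun _ => Matrix.single ⟨0, by omega⟩ ⟨1, by omega⟩ 1) fun _ => rfl
  have h3 := hc fun _ => Matrix.single ⟨0, by omega⟩ ⟨1, by omega⟩ 1
  rw [h2] at h1 h3
  -- The common norm factor is positive because the sides of the equality case are nonzero, so it
  -- cancels.
  exact le_of_mul_le_mul_right h3 (pos_of_mul_pos_right h1 (by positivity))
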